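/- Let $q>2$ be a power of a prime $p$, let $\mathcal M$ be a multiset of points of the desarguesian affine plane $\mathrm{AG}(2,q)$, and let $\lambda$ be an integer with $0<\lambda\le (q-1)/2$. Call a direction (one of the $q+1$ parallel classes of affine lines) $(q-\lambda)$-uniform if at least $q-\lambda$ of its $q$ lines meet $\mathcal M$ in the same number of points modulo $p$, points being counted with multiplicity; since $\lambda\le (q-1)/2$, this number is unique modulo $p$. The remaining lines of a $(q-\lambda)$-uniform direction, i.e. those that meet $\mathcal M$ in a different number of points modulo $p$, are called renitent. Let $\mathcal F_\lambda$ be the set of all $(q-\lambda)$-uniform directions. If $|\mathcal F_\lambda|>\lambda^2+\lambda$, then every point $R$ of $\mathrm{AG}(2,q)$ is incident with at most $\lambda$ or with at least $|\mathcal F_\lambda|+1-\lambda$ renitent lines. -/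

import Mathlib

/-! The affine plane `AG(2,q)` is `K × K` for a finite field `K` with `q` elements.  Its directions
(the points of the line at infinity) are the points of `ℙ K (K × K)`.  The characteristic `p` is
`ringChar K`. -/

open scoped LinearAlgebra.Projectivization

namespace AffinePlane

variable {K : Type*} [Field K]

/-- The affine lines with direction `d`: the affine subspaces whose space of translations is the
one-dimensional subspace `d` (the empty subspace does not qualify, as its direction is `⊥`). -/
def parallelClass (d : ℙ K (K × K)) : Set (AffineSubspace K (K × K)) :=
  {l | l.direction = d.submodule}

open Classical in
/-- The number of points of the multiset `M`, counted with multiplicity, on `l`. -/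
noncomputable def intersectionNumber (M : Multiset (K × K)) (l : AffineSubspace K (K × K)) : ℕ :=
  M.countP (fun P => P ∈ l)

/-- At least `q - lam` affine lines with direction `d` meet `M` in `m` points modulo `p`. For
`lam ≤ (q - 1) / 2` such an `m` is unique modulo `p`: the typical intersection number at `d`. -/
def IsTypicalNumber (M : Multiset (K × K)) (lam : ℕ) (d : ℙ K (K × K)) (m : ℕ) : Prop :=
  Nat.card K ≤
    {l ∈ parallelClass d | intersectionNumber M l ≡ m [MOD ringChar K]}.ncard + lam

/-- The set of the `(q - lam)`-uniform directions of `M`. -/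
def uniformDirections (M : Multiset (K × K)) (lam : ℕ) : Set (ℙ K (K × K)) :=
  {d | ∃ m : ℕ, IsTypicalNumber M lam d m}

/-- A line is renitent if its direction is `(q - lam)`-uniform and it does not meet `M` in the
typical number of points modulo `p`. -/
def IsRenitent (M : Multiset (K × K)) (lam : ℕ) (l : AffineSubspace K (K × K)) : Prop :=
  ∃ (d : ℙ K (K × K)) (m : ℕ), IsTypicalNumber M lam d m ∧ l ∈ parallelClass d ∧
    ¬ intersectionNumber M l ≡ m [MOD ringChar K]

/-- The set of the renitent lines incident with the point `R`. -/
def renitentLinesThrough (M : Multiset (K × K)) (lam : ℕ) (R : K × K) :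
    Set (AffineSubspace K (K × K)) :=
  {l | IsRenitent M lam l ∧ R ∈ l}

end AffinePlane

/-! Take coordinates with origin `R` in which a chosen direction `v` is vertical, and write the
lines of slope y as b - ya = t. The power sums π_k(Y) = ∑ (b - Ya)^k over the points of `M` have
degree at most k in Y. As ∑ t^k = 0 over K for k < q - 1, the typical number can be subtracted from
all intersection numbers: at a uniform slope y, π_k(y) = ∑ w t^k over the renitent intercepts t
alone, with nonzero weights w (`isMomentSystem_exceptional`).

Let μ ≤ lam be the largest number of renitent lines in one of these directions. The intercepts of
each slope then satisfy a linear recurrence of order μ. Dimension counts produce one polynomial Q(X,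
Y), of degree μ in X and of total degree at most μ, that vanishes at every renitent (t, y)
(`exists_recurrence_tdeg_le`).

The point `R` is t = 0. If Q(0, Y) ≠ 0, it has at most μ roots, so at most μ renitent lines pass
through `R`. If Q = XP, the functional X^k ↦ π_k sends P to a nonzero polynomial of degree less than
μ that vanishes at every slope in which the line through `R` is not renitent
(`card_filter_zero_mem`).

The direction `v` is lost in this argument. A nonuniform `v` costs nothing; if all directions are
uniform, two choices of `v` are compared. -/

open scoped LinearAlgebra.Projectivization

namespace AffinePlane

open Polynomial Finset

/-! ### Total degree of polynomials in X (outer) and Y (inner), and dimensions of truncated spaces.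
-/

section TotalDegree

variable {K : Type*} [Field K]

/-- The substitution `G(X, Y) ↦ G(X, XY)`, which turns the total degree into the degree in `X`. -/
noncomputable def twist : K[X][X] →+* K[X][X] :=
  eval₂RingHom (eval₂RingHom (C.comp C) (C X * X)) X

theorem coeff_twist (G : K[X][X]) (s a : ℕ) :
    ((twist G).coeff s).coeff a = if a ≤ s then (G.coeff (s - a)).coeff a else 0 := by
  induction G using Polynomial.induction_on' with
  | add p q hp hq =>
    rw [map_add, coeff_add, coeff_add, hp, hq]
    split_ifs <;> simp
  | monomial j f =>
    induction f using Polynomial.induction_on' with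
    | add p q hp hq =>
      rw [map_add, map_add, coeff_add, coeff_add, hp, hq]
      split_ifs <;> simp
    | monomial b c =>
      have h : twist (monomial j (monomial b c)) = monomial (b + j) (monomial b c) := by
        simp only [twist, coe_eval₂RingHom, eval₂_monomial, RingHom.comp_apply]
        rw [mul_pow, ← C_pow, ← mul_assoc, ← C_mul, mul_assoc, ← pow_add,
          C_mul_X_pow_eq_monomial, C_mul_X_pow_eq_monomial]
      rw [h]
      simp only [coeff_monomial]
      by_cases h1 : b = a
      · subst h1
        by_cases h2 : b + j = s
        · subst h2; simp
        · have : ¬ (b ≤ s ∧ j = s - b) := by omega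
          rw [if_neg h2]
          split_ifs with h3 h4 <;> simp_all
      · split_ifs <;> simp [coeff_monomial, h1]

/-- The total degree of a polynomial in two variables. -/
noncomputable def tdeg (G : K[X][X]) : ℕ := (twist G).natDegree

theorem tdeg_le_iff {G : K[X][X]} {n : ℕ} :
    tdeg G ≤ n ↔ ∀ j a, n < j + a → (G.coeff j).coeff a = 0 := by
  rw [tdeg, natDegree_le_iff_coeff_eq_zero]
  constructor
  · intro h j a hja
    have := congrArg (fun f => f.coeff a) (h (j + a) (by exact_mod_cast hja))
    simpa [coeff_twist] using this
  · intro h s hs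
    ext a
    rw [coeff_twist, coeff_zero]
    split_ifs with ha
    · exact h _ _ (by omega)
    · rfl

theorem twist_injective : Function.Injective (twist (K := K)) := by
  rw [injective_iff_map_eq_zero]
  intro G hG
  ext j a
  have := coeff_twist G (j + a) a
  simpa [hG] using this.symm

/-- `twist` is an injective ring homomorphism, so additivity is inherited from the degree over the
domain K[Y]. -/
theorem tdeg_mul {G H : K[X][X]} (hG : G ≠ 0) (hH : H ≠ 0) :
    tdeg (G * H) = tdeg G + tdeg H := by
  rw [tdeg, map_mul, natDegree_mul]
  · rfl
  · exact (map_ne_zero_iff _ twist_injective).2 hG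
  · exact (map_ne_zero_iff _ twist_injective).2 hH

theorem tdeg_X_pow (i : ℕ) : tdeg (X ^ i : K[X][X]) = i := by
  simp [tdeg, twist]

theorem natDegree_coeff_add_le (G : K[X][X]) {j : ℕ} (hj : G.coeff j ≠ 0) :
    (G.coeff j).natDegree + j ≤ tdeg G := by
  by_contra! h
  exact hj (leadingCoeff_eq_zero.1 (tdeg_le_iff.1 le_rfl j _ (by omega)))

theorem natDegree_le_tdeg_C (r : K[X]) : r.natDegree ≤ tdeg (C r) := by
  by_cases hr : r = 0
  · simp [hr]
  · simpa using natDegree_coeff_add_le (C r) (j := 0) (by simpa using hr)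

theorem tdeg_X_pow_mul_le (i : ℕ) (G : K[X][X]) : tdeg (X ^ i * G) ≤ i + tdeg G := by
  by_cases hG : G = 0
  · simp [hG, tdeg]
  · rw [tdeg_mul (pow_ne_zero _ X_ne_zero) hG, tdeg_X_pow]

/-- The polynomials of degree less than `k` in the outer variable and of total degree at most
`n`. -/
noncomputable def box (K : Type*) [Field K] (n k : ℕ) : Submodule K K[X][X] where
  carrier := {G | G.degree < k ∧ tdeg G ≤ n}
  add_mem' := by
    rintro G H ⟨h1, h2⟩ ⟨h3, h4⟩
    refine ⟨(degree_add_le _ _).trans_lt (max_lt h1 h3), ?_⟩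
    rw [tdeg_le_iff] at *
    intro j a hja
    simp [h2 j a hja, h4 j a hja]
  zero_mem' := by simp [tdeg, bot_lt_iff_ne_bot]
  smul_mem' := by
    rintro c G ⟨h1, h2⟩
    refine ⟨(degree_smul_le _ _).trans_lt h1, ?_⟩
    rw [tdeg_le_iff] at *
    intro j a hja
    simp [h2 j a hja]

theorem mem_box {n k : ℕ} {G : K[X][X]} : G ∈ box K n k ↔ G.degree < k ∧ tdeg G ≤ n := Iff.rfl

/-- The exponents of the monomials in `box K n k`. -/
def boxExponents (n k : ℕ) : Finset (Σ _ : ℕ, ℕ) := (range k).sigma fun j => range (n + 1 - j)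

theorem mem_boxExponents {n k : ℕ} {p : Σ _ : ℕ, ℕ} :
    p ∈ boxExponents n k ↔ p.1 < k ∧ p.1 + p.2 ≤ n := by
  simp only [boxExponents, mem_sigma, mem_range]
  omega

theorem card_boxExponents (n k : ℕ) : #(boxExponents n k) = ∑ j ∈ range k, (n + 1 - j) := by
  simp [boxExponents]

/-- The coefficients of a polynomial in `box K n k`. -/
noncomputable def boxEquiv (K : Type*) [Field K] (n k : ℕ) :
    box K n k ≃ₗ[K] (boxExponents n k → K) where
  toFun G p := (G.1.coeff p.1.1).coeff p.1.2
  map_add' _ _ := by ext; simp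
  map_smul' _ _ := by ext; simp
  invFun f := ⟨∑ p, monomial p.1.1 (monomial p.1.2 (f p)), by
    refine Submodule.sum_mem _ fun p _ => ?_
    obtain ⟨h1, h2⟩ := mem_boxExponents.1 p.2
    refine mem_box.2 ⟨(degree_monomial_le _ _).trans_lt (by exact_mod_cast h1), ?_⟩
    rw [tdeg_le_iff]
    intro j a hja
    rw [coeff_monomial]
    split_ifs with h3
    · rw [coeff_monomial, if_neg (by omega)]
    · simp⟩
  left_inv G := by
    obtain ⟨G, hG1, hG2⟩ := G
    ext j a
    simp only [finsetSum_coeff, coeff_monomial]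
    by_cases h : (⟨j, a⟩ : Σ _ : ℕ, ℕ) ∈ boxExponents n k
    · rw [Finset.sum_eq_single ⟨⟨j, a⟩, h⟩]
      · simp
      · rintro ⟨⟨i, b⟩, hb⟩ - hne
        dsimp only
        split_ifs with h1
        · subst h1
          rw [coeff_monomial, if_neg]
          rintro rfl
          exact hne rfl
        · simp
      · simp
    · rw [Finset.sum_eq_zero]
      · symm
        rw [mem_boxExponents] at h
        by_cases hj : j < k
        · exact tdeg_le_iff.1 hG2 j a (by simp only at h; omega)
        · rw [coeff_eq_zero_of_degree_lt (hG1.trans_le (by exact_mod_cast not_lt.1 hj)), coeff_zero]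
      · rintro ⟨⟨i, b⟩, hb⟩ -
        dsimp only
        split_ifs with h1
        · subst h1
          rw [coeff_monomial, if_neg]
          rintro rfl
          exact h hb
        · simp
  right_inv f := by
    ext ⟨⟨j, a⟩, h⟩
    simp only [finsetSum_coeff, coeff_monomial]
    rw [Finset.sum_eq_single ⟨⟨j, a⟩, h⟩]
    · simp
    · rintro ⟨⟨i, b⟩, hb⟩ - hne
      dsimp only
      split_ifs with h1
      · subst h1
        rw [coeff_monomial, if_neg]
        rintro rfl
        exact hne rfl
      · simp
    · simp

instance (n k : ℕ) : Module.Finite K (box K n k) := Module.Finite.equiv (boxEquiv K n k).symm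

theorem finrank_box (n k : ℕ) : Module.finrank K (box K n k) = ∑ j ∈ range k, (n + 1 - j) := by
  rw [(boxEquiv K n k).finrank_eq, Module.finrank_fintype_fun_eq_card, Fintype.card_coe,
    card_boxExponents]

end TotalDegree

/-! ### The moment functional and the module of recurrences. -/

section Moments

variable {K : Type*} [Field K]

/-- The `K[Y]`-linear functional on `K[Y][X]` that sends `X ^ j` to `π j`. -/
noncomputable def momentFunctional (π : ℕ → K[X]) : K[X][X] →ₗ[K[X]] K[X] :=
  lsum fun j => LinearMap.mulRight K[X] (π j)

theorem momentFunctional_apply (π : ℕ → K[X]) (G : K[X][X]) {n : ℕ} (hn : G.natDegree < n) :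
    momentFunctional π G = ∑ j ∈ range n, G.coeff j * π j := by
  rw [momentFunctional, lsum_apply, sum_over_range' _ _ _ hn]
  · simp
  · simp

/-- Replacing X^j by a polynomial of degree at most j in Y cannot raise the total degree. -/
theorem natDegree_momentFunctional_le {π : ℕ → K[X]} (hπ : ∀ k, (π k).natDegree ≤ k)
    (G : K[X][X]) : (momentFunctional π G).natDegree ≤ tdeg G := by
  rw [momentFunctional_apply π G (Nat.lt_succ_self _)]
  refine natDegree_sum_le_of_forall_le _ _ fun j _ => ?_
  by_cases hj : G.coeff j = 0
  · simp [hj]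
  · exact natDegree_mul_le.trans
      ((Nat.add_le_add_left (hπ j) _).trans (natDegree_coeff_add_le G hj))

/-- The polynomials `G` such that `G, X G, …, X ^ (μ - 1) G` have moment zero. -/
noncomputable def recurrences (π : ℕ → K[X]) (μ : ℕ) : Submodule K[X] K[X][X] :=
  ⨅ i ∈ range μ, LinearMap.ker (momentFunctional π ∘ₗ LinearMap.mulLeft K[X] (X ^ i))

theorem mem_recurrences {π : ℕ → K[X]} {μ : ℕ} {G : K[X][X]} :
    G ∈ recurrences π μ ↔ ∀ i < μ, momentFunctional π (X ^ i * G) = 0 := by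
  simp [recurrences]

theorem C_mul_mem_recurrences {π : ℕ → K[X]} {μ : ℕ} {c : K[X]} {G : K[X][X]} (hc : c ≠ 0) :
    C c * G ∈ recurrences π μ ↔ G ∈ recurrences π μ := by
  rw [← smul_eq_C_mul, mem_recurrences, mem_recurrences]
  refine forall₂_congr fun i _ => ?_
  rw [mul_smul_comm, map_smul, smul_eq_zero_iff_right hc]

theorem finrank_le_sum_add_finrank_iInf_ker {V : Type*} [AddCommGroup V] [Module K V]
    [Module.Finite K V] {μ : ℕ} (g : Fin μ → V →ₗ[K] K[X]) (b : ℕ → ℕ)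
    (hg : ∀ (i : Fin μ) v, g i v ∈ degreeLT K (b i)) :
    Module.finrank K V ≤ (∑ i ∈ range μ, b i) +
      Module.finrank K (⨅ i, LinearMap.ker (g i) : Submodule K V) := by
  let Ψ : V →ₗ[K] (∀ i : Fin μ, degreeLT K (b i)) :=
    LinearMap.pi fun i => (g i).codRestrict _ (hg i)
  have h1 := LinearMap.finrank_range_add_finrank_ker Ψ
  have h2 : Module.finrank K (LinearMap.range Ψ) ≤ ∑ i ∈ range μ, b i := by
    have : ∀ i : Fin μ, Module.Finite K (degreeLT K (b i)) := fun i =>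
      Module.Finite.equiv (degreeLTEquiv K _).symm
    refine (Submodule.finrank_le _).trans ?_
    rw [Module.finrank_pi_fintype, ← Fin.sum_univ_eq_sum_range b]
    refine (Finset.sum_congr rfl fun i _ => ?_).le
    rw [(degreeLTEquiv K _).finrank_eq, Module.finrank_fin_fun]
  have h3 : LinearMap.ker Ψ = ⨅ i, LinearMap.ker (g i) := by
    rw [LinearMap.ker_pi]
    simp only [LinearMap.ker_codRestrict]
  rw [h3] at h1
  omega

/-- The moment of X^i G has degree at most n + i, so its vanishing imposes at most n + i + 1 scalar
equations on G. -/
theorem finrank_box_le {π : ℕ → K[X]} (hπ : ∀ k, (π k).natDegree ≤ k) (n k μ : ℕ) :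
    Module.finrank K (box K n k) ≤ (∑ i ∈ range μ, (n + i + 1)) +
      Module.finrank K (box K n k ⊓ (recurrences π μ).restrictScalars K : Submodule K K[X][X]) := by
  let g : Fin μ → box K n k →ₗ[K] K[X] := fun i =>
    ((momentFunctional π ∘ₗ LinearMap.mulLeft K[X] (X ^ (i : ℕ))).restrictScalars K).domRestrict _
  have hg : ∀ i (G : box K n k), g i G = momentFunctional π (X ^ (i : ℕ) * G.1) :=
    fun _ _ => rfl
  refine (finrank_le_sum_add_finrank_iInf_ker (K := K) (V := box K n k) (μ := μ) g (fun i => n + i + 1) fun i G => ?_).trans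
    (Nat.add_le_add_left ?_ _)
  · rw [hg, mem_degreeLT]
    have h1 := natDegree_momentFunctional_le hπ (X ^ (i : ℕ) * G.1)
    have h2 := tdeg_X_pow_mul_le i G.1
    have h3 := (mem_box.1 G.2).2
    exact degree_le_natDegree.trans_lt (by exact_mod_cast (by omega :
      (momentFunctional π (X ^ (i : ℕ) * G.1)).natDegree < n + i + 1))
  · rw [← Submodule.finrank_map_subtype_eq]
    refine Submodule.finrank_mono ?_
    rintro _ ⟨G, hG, rfl⟩
    refine ⟨G.2, ?_⟩
    change G.1 ∈ recurrences π μ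
    rw [mem_recurrences]
    intro i hi
    rw [← hg ⟨i, hi⟩]
    exact (Submodule.mem_iInf _).1 hG ⟨i, hi⟩

theorem momentFunctional_mul_eq_zero {π : ℕ → K[X]} {μ : ℕ} {F G : K[X][X]}
    (hG : G ∈ recurrences π μ) (hF : F.degree < μ) : momentFunctional π (F * G) = 0 := by
  rw [F.as_sum_range_C_mul_X_pow, Finset.sum_mul, map_sum]
  refine Finset.sum_eq_zero fun i _ => ?_
  by_cases hi : F.coeff i = 0
  · simp [hi]
  · rw [mul_assoc, ← smul_eq_C_mul, map_smul, mem_recurrences.1 hG i, smul_zero]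
    exact_mod_cast (le_degree_of_ne_zero hi).trans_lt hF

/-- Sets `T y` of at most `μ` points with non-zero weights, indexed by the elements `y` of a finite
set, whose power sums of order less than `L` are the values of polynomials `π k` of degree at most
`k`. -/
structure IsMomentSystem (π : ℕ → K[X]) (S : Finset K) (T : K → Finset K) (w : K → K → K)
    (L μ : ℕ) : Prop where
  natDegree_le : ∀ k, (π k).natDegree ≤ k
  weight_ne_zero : ∀ y ∈ S, ∀ t ∈ T y, w y t ≠ 0
  eval_eq : ∀ k < L, ∀ y ∈ S, (π k).eval y = ∑ t ∈ T y, w y t * t ^ k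
  card_le : ∀ y ∈ S, #(T y) ≤ μ

/-- The specialization of `G(X, Y)` at `Y = y`. -/
noncomputable abbrev specialize (y : K) (G : K[X][X]) : K[X] := G.map (evalRingHom y)

namespace IsMomentSystem

variable {π : ℕ → K[X]} {S : Finset K} {T : K → Finset K} {w : K → K → K} {L μ : ℕ}
  (h : IsMomentSystem π S T w L μ)

include h

theorem eval_momentFunctional {G : K[X][X]} (hG : G.natDegree < L) {y : K} (hy : y ∈ S) :
    (momentFunctional π G).eval y = ∑ t ∈ T y, w y t * (specialize y G).eval t := by
  rw [momentFunctional_apply π G (Nat.lt_succ_self _), eval_finsetSum]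
  have h1 : ∀ t, (specialize y G).eval t =
      ∑ j ∈ range (G.natDegree + 1), (G.coeff j).eval y * t ^ j := fun t => by
    rw [eval_eq_sum_range' (n := G.natDegree + 1) (Nat.lt_succ_of_le natDegree_map_le)]
    simp
  simp only [h1, Finset.mul_sum]
  rw [Finset.sum_comm]
  refine Finset.sum_congr rfl fun j hj => ?_
  rw [eval_mul, h.eval_eq j (by simp at hj; omega) y hy, Finset.mul_sum]
  exact Finset.sum_congr rfl fun t _ => by ring

/-- Multiplying G by the product of X - s over the other points s of `T y`, of degree less than μ,
keeps the moment zero and isolates the term of t, whose weight is nonzero. -/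
theorem eval_specialize_eq_zero {G : K[X][X]} (hG : G ∈ recurrences π μ)
    (hL : G.natDegree + μ ≤ L) {y t : K} (hy : y ∈ S) (ht : t ∈ T y) :
    (specialize y G).eval t = 0 := by
  classical
  let f : K[X] := ∏ s ∈ (T y).erase t, (X - C s)
  have hfd : f.natDegree < μ := by
    have h1 : f.natDegree = #((T y).erase t) := by simp [f, natDegree_prod_of_monic, monic_X_sub_C]
    have h2 := h.card_le y hy
    have h3 := card_pos.2 ⟨t, ht⟩
    rw [h1, card_erase_of_mem ht]
    omega
  have hF : (f.map C).natDegree < μ := natDegree_map_le.trans_lt hfd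
  have h0 := momentFunctional_mul_eq_zero (F := f.map C) hG
    (degree_le_natDegree.trans_lt (by exact_mod_cast hF))
  have h1 := h.eval_momentFunctional (G := f.map C * G)
    (natDegree_mul_le.trans_lt (by omega)) hy
  have h2 : specialize y (f.map C) = f := by
    rw [specialize, Polynomial.map_map]
    convert Polynomial.map_id
    ext; simp
  rw [h0, eval_zero, Finset.sum_eq_single t] at h1
  · rw [specialize, Polynomial.map_mul, eval_mul] at h1
    rw [show (f.map C).map (evalRingHom y) = f from h2] at h1
    have h3 : f.eval t ≠ 0 := by
      rw [eval_prod, Finset.prod_ne_zero_iff]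
      intro s hs
      simpa [sub_eq_zero] using (ne_of_mem_erase hs).symm
    have h4 := h.weight_ne_zero y hy t ht
    simpa [h3, h4] using h1.symm
  · intro s hs hst
    rw [specialize, Polynomial.map_mul, eval_mul,
      show (f.map C).map (evalRingHom y) = f from h2]
    have : f.eval s = 0 := by
      rw [eval_prod]
      exact Finset.prod_eq_zero (mem_erase.2 ⟨hst, hs⟩) (by simp)
    simp [this]
  · exact fun h' => absurd ht h'

/-- The moment is a polynomial in Y with more roots than its degree bound `tdeg G`. This is a
partial converse of `eval_specialize_eq_zero`. -/
theorem momentFunctional_eq_zero {G : K[X][X]} (hL : G.natDegree < L) (hS : tdeg G < #S)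
    (hG : ∀ y ∈ S, ∀ t ∈ T y, (specialize y G).eval t = 0) : momentFunctional π G = 0 := by
  refine eq_zero_of_natDegree_lt_card_of_eval_eq_zero' _ S (fun y hy => ?_)
    ((natDegree_momentFunctional_le h.natDegree_le G).trans_lt hS)
  rw [h.eval_momentFunctional hL hy]
  exact Finset.sum_eq_zero fun t ht => by rw [hG y hy t ht, mul_zero]

/-- At a slope y with μ points, G(X, y) has more roots than its degree, so Y - y divides G. The
quotient is again a recurrence, and descent on the total degree concludes. -/
theorem eq_zero_of_degree_lt (hL : 2 * μ ≤ L) {y : K} (hy : y ∈ S) (hTy : #(T y) = μ)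
    {G : K[X][X]} (hG : G ∈ recurrences π μ) (hGd : G.degree < μ) : G = 0 := by
  by_contra hne
  induction hn : tdeg G using Nat.strong_induction_on generalizing G with
  | _ n ih =>
    have hGd' : G.natDegree < μ := (natDegree_lt_iff_degree_lt hne).2 hGd
    have h0 : specialize y G = 0 :=
      eq_zero_of_natDegree_lt_card_of_eval_eq_zero' _ (T y)
        (fun t ht => h.eval_specialize_eq_zero hG (by omega) hy ht)
        (natDegree_map_le.trans_lt (by omega))
    have h1 : C (X - C y) ∣ G := by
      rw [C_dvd_iff_dvd_coeff]
      intro i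
      rw [dvd_iff_isRoot, IsRoot.def]
      simpa using congrArg (fun f => f.coeff i) h0
    obtain ⟨H, rfl⟩ := h1
    have hy0 : (X - C y : K[X]) ≠ 0 := X_sub_C_ne_zero y
    have hH : H ≠ 0 := right_ne_zero_of_mul hne
    rw [tdeg_mul (C_ne_zero.2 hy0) hH] at hn
    have h2 := natDegree_le_tdeg_C (X - C y)
    rw [natDegree_X_sub_C] at h2
    refine ih (tdeg H) (by omega) ((C_mul_mem_recurrences hy0).1 hG) ?_ hH rfl
    rwa [degree_mul, degree_C hy0, zero_add] at hGd

/-- Pseudo-division by Q in X stays among the recurrences, so the remainder, of degree less than μ,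
is zero. Gauss's lemma removes the factor from K[Y]. -/
theorem dvd_of_mem_recurrences (hL : 2 * μ ≤ L) {y : K} (hy : y ∈ S) (hTy : #(T y) = μ)
    {Q : K[X][X]} (hQ : Q.IsPrimitive) (hQd : Q.natDegree = μ) {N : ℕ}
    (hQN : ∀ i < N, momentFunctional π (X ^ i * Q) = 0) {G : K[X][X]}
    (hG : G ∈ recurrences π μ) (hGd : G.natDegree ≤ N) : Q ∣ G := by
  have hQ0 : Q ≠ 0 := hQ.ne_zero
  have hlc : Q.leadingCoeff ≠ 0 := leadingCoeff_ne_zero.2 hQ0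
  suffices H : ∃ c : K[X], c ≠ 0 ∧ Q ∣ C c * G by
    obtain ⟨c, hc, hdvd⟩ := H
    refine hQ.dvd_of_fraction_map_dvd_fraction_map (K := FractionRing K[X]) ?_
    have h1 := Polynomial.map_dvd (algebraMap K[X] (FractionRing K[X])) hdvd
    rw [Polynomial.map_mul, map_C] at h1
    refine (IsUnit.dvd_mul_left ?_).1 h1
    rw [isUnit_C, isUnit_iff_ne_zero]
    simpa using hc
  induction hn : G.degree using WellFoundedLT.induction generalizing G with
  | _ n ih =>
    by_cases hlt : G.degree < μ
    · exact ⟨1, one_ne_zero, by simp [h.eq_zero_of_degree_lt hL hy hTy hG hlt]⟩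
    have hG0 : G ≠ 0 := by
      rintro rfl
      simp at hlt
    have hμG : μ ≤ G.natDegree := by
      rw [degree_eq_natDegree hG0] at hlt
      exact_mod_cast not_lt.1 hlt
    set s := G.natDegree - μ with hs
    let H := C Q.leadingCoeff * G - C G.leadingCoeff * (X ^ s * Q)
    have hH : H.degree < G.degree := by
      have hd1 : (C Q.leadingCoeff * G).degree = G.degree := by
        rw [degree_mul, degree_C hlc, zero_add]
      have hd2 : (C G.leadingCoeff * (X ^ s * Q)).degree = G.degree := by
        rw [degree_mul, degree_C (leadingCoeff_ne_zero.2 hG0), zero_add, degree_mul, degree_X_pow,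
          degree_eq_natDegree hQ0, degree_eq_natDegree hG0, hQd]
        exact_mod_cast by omega
      rw [← hd1]
      refine degree_sub_lt_left (hd1.trans hd2.symm) (mul_ne_zero (C_ne_zero.2 hlc) hG0) ?_
      simp [leadingCoeff_mul, mul_comm]
    have hHI : H ∈ recurrences π μ := by
      refine Submodule.sub_mem _ ?_ ?_
      · rw [← smul_eq_C_mul]; exact Submodule.smul_mem _ _ hG
      · rw [← smul_eq_C_mul]
        refine Submodule.smul_mem _ _ (mem_recurrences.2 fun i hi => ?_)
        rw [← mul_assoc, ← pow_add]
        -- Here i < μ and s ≤ N - μ, so the exponent is below N.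
        exact hQN _ (by omega)
    obtain ⟨c, hc, hdvd⟩ := ih H.degree (hn ▸ hH) hHI
      ((natDegree_le_natDegree hH.le).trans hGd) rfl
    refine ⟨c * Q.leadingCoeff, mul_ne_zero hc hlc, ?_⟩
    have : C (c * Q.leadingCoeff) * G = C c * H + C (c * G.leadingCoeff) * X ^ s * Q := by
      simp only [H, C_mul]; ring
    rw [this]
    exact dvd_add hdvd (dvd_mul_left _ _)

end IsMomentSystem

end Moments

/-! ### Dimension counts and the curve of degree μ. -/

section Counting

theorem two_mul_sum_range_sub {n k : ℕ} (hk : k ≤ n + 1) :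
    (2 * ((∑ j ∈ range k, (n + 1 - j) : ℕ) : ℤ)) = k * (2 * n + 3 - k) := by
  induction k with
  | zero => simp
  | succ k ih =>
    rw [sum_range_succ, Nat.cast_add, mul_add, ih (by omega), Nat.cast_sub (by omega)]
    push_cast
    ring

theorem two_mul_sum_range_add (n k : ℕ) :
    2 * ((∑ i ∈ range k, (n + i + 1) : ℕ) : ℤ) = k * (2 * n + 1 + k) := by
  induction k with
  | zero => simp
  | succ k ih =>
    rw [sum_range_succ, Nat.cast_add, mul_add, ih]
    push_cast
    ring

variable {K : Type*} [Field K]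

/-- With total degree μ ^ 2 the unknowns outnumber the equations by exactly one. -/
theorem exists_recurrence {π : ℕ → K[X]} (hπ : ∀ k, (π k).natDegree ≤ k) (μ : ℕ) :
    ∃ Q ∈ recurrences π μ, Q ≠ 0 ∧ Q.natDegree ≤ μ ∧ tdeg Q ≤ μ ^ 2 := by
  have h1 := finrank_box_le hπ (μ ^ 2) (μ + 1) μ
  rw [finrank_box] at h1
  have h2 := two_mul_sum_range_sub (n := μ ^ 2) (k := μ + 1) (by nlinarith)
  have h3 := two_mul_sum_range_add (μ ^ 2) μ
  have h4 : (box K (μ ^ 2) (μ + 1) ⊓ (recurrences π μ).restrictScalars K :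
      Submodule K K[X][X]) ≠ ⊥ := by
    intro h0
    rw [h0, finrank_bot, add_zero] at h1
    zify at h1
    push_cast at h1 h2 h3
    nlinarith
  obtain ⟨Q, ⟨hQb, hQr⟩, hQ0⟩ := Submodule.exists_mem_ne_zero_of_ne_bot h4
  refine ⟨Q, hQr, hQ0, ?_, hQb.2⟩
  have := (natDegree_lt_iff_degree_lt hQ0).2 hQb.1
  omega

theorem specialize_mul_eval (y t : K) (F G : K[X][X]) :
    (specialize y (F * G)).eval t = (specialize y F).eval t * (specialize y G).eval t := by
  rw [specialize, Polynomial.map_mul, eval_mul]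

namespace IsMomentSystem

variable {π : ℕ → K[X]} {S : Finset K} {T : K → Finset K} {w : K → K → K} {L μ : ℕ}
  (h : IsMomentSystem π S T w L μ)

include h

/-- If there are more than `μ ^ 2 + μ` slopes, then all the points `(t, y)` with `t ∈ T y` lie on a
curve of degree `μ`. -/
theorem exists_recurrence_tdeg_le (hμ : 0 < μ) (hL : μ ^ 2 + μ ≤ L) (hS : μ ^ 2 + μ < #S) {y : K}
    (hy : y ∈ S) (hTy : #(T y) = μ) :
    ∃ Q ∈ recurrences π μ, Q.natDegree = μ ∧ tdeg Q ≤ μ := by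
  classical
  have hL2 : 2 * μ ≤ L := by nlinarith
  -- Q is chosen of minimal total degree, which forces it to be primitive over K[Y].
  have hex : ∃ n, ∃ Q ∈ recurrences π μ, Q ≠ 0 ∧ Q.natDegree ≤ μ ∧ tdeg Q = n := by
    obtain ⟨Q, h1, h2, h3, -⟩ := exists_recurrence h.natDegree_le μ
    exact ⟨_, Q, h1, h2, h3, rfl⟩
  obtain ⟨Q, hQI, hQ0, hQd', hQt⟩ := Nat.find_spec hex
  have hmin : ∀ Q' ∈ recurrences π μ, Q' ≠ 0 → Q'.natDegree ≤ μ → tdeg Q ≤ tdeg Q' := by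
    intro Q' h1 h2 h3
    rw [hQt]
    exact Nat.find_min' hex ⟨Q', h1, h2, h3, rfl⟩
  have hQle : tdeg Q ≤ μ ^ 2 := by
    obtain ⟨Q', h1, h2, h3, h4⟩ := exists_recurrence h.natDegree_le μ
    exact (hmin Q' h1 h2 h3).trans h4
  clear hQt
  have hQd : Q.natDegree = μ := by
    by_contra hne
    refine hQ0 (h.eq_zero_of_degree_lt hL2 hy hTy hQI ?_)
    exact (natDegree_lt_iff_degree_lt hQ0).1 (by omega)
  refine ⟨Q, hQI, hQd, ?_⟩
  by_contra! hlt
  obtain ⟨e, he⟩ := Nat.exists_eq_add_of_lt hlt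
  have hprim : Q.IsPrimitive := by
    rintro r ⟨Q', rfl⟩
    have hr : C r ≠ 0 := left_ne_zero_of_mul hQ0
    have hQ' : Q' ≠ 0 := right_ne_zero_of_mul hQ0
    have hr' : r ≠ 0 := by simpa using hr
    have h1 := hmin Q' ((C_mul_mem_recurrences hr').1 hQI) hQ' (by
      rwa [natDegree_mul hr hQ', natDegree_C, zero_add] at hQd')
    rw [tdeg_mul hr hQ'] at h1
    have h2 := natDegree_le_tdeg_C r
    rw [isUnit_iff_degree_eq_zero, degree_eq_natDegree hr']
    exact_mod_cast (by omega : r.natDegree = 0)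
  -- As tdeg Q = μ + e + 1, X^i Q has total degree at most μ ^ 2 + μ < #S for i < N, so its moment
  -- vanishes in this range too.
  obtain ⟨N, hN⟩ : ∃ N, N + e = μ ^ 2 := ⟨μ ^ 2 - e, by omega⟩
  have hQN : ∀ i < N, momentFunctional π (X ^ i * Q) = 0 := by
    intro i hi
    refine h.momentFunctional_eq_zero ?_ ?_ fun y hy t ht => ?_
    · refine natDegree_mul_le.trans_lt ?_
      rw [natDegree_X_pow]
      omega
    · have := tdeg_X_pow_mul_le i Q
      omega
    · rw [specialize_mul_eval, h.eval_specialize_eq_zero hQI (by omega) hy ht, mul_zero]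
  -- Any large n would do: it cancels from the count and only has to keep the subtractions from
  -- truncating.
  set n := 2 * μ ^ 2 + 2 * μ with hn
  have h1 := finrank_box_le h.natDegree_le n (N + 1) μ
  have h2 : (box K n (N + 1) ⊓ (recurrences π μ).restrictScalars K : Submodule K K[X][X]) ≤
      (box K (n - tdeg Q) (N + 1 - μ)).map (LinearMap.mulLeft K Q) := by
    rintro G ⟨hGb, hGr⟩
    by_cases hG0 : G = 0
    · rw [hG0]; exact Submodule.zero_mem _
    have hGd := (natDegree_lt_iff_degree_lt hG0).2 hGb.1
    obtain ⟨E, rfl⟩ := h.dvd_of_mem_recurrences hL2 hy hTy hprim hQd hQN hGr (by omega)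
    have hE : E ≠ 0 := right_ne_zero_of_mul hG0
    have hGt := hGb.2
    rw [tdeg_mul hQ0 hE] at hGt
    rw [natDegree_mul hQ0 hE] at hGd
    refine ⟨E, mem_box.2 ⟨(natDegree_lt_iff_degree_lt hE).1 (by omega), by omega⟩, rfl⟩
  have h3 := (Submodule.finrank_mono h2).trans (Submodule.finrank_map_le _ _)
  replace h1 := h1.trans (Nat.add_le_add_left h3 _)
  rw [finrank_box, finrank_box] at h1
  have h4 := two_mul_sum_range_sub (n := n) (k := N + 1) (by omega)
  have h5 := two_mul_sum_range_sub (n := n - tdeg Q) (k := N + 1 - μ) (by omega)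
  have h6 := two_mul_sum_range_add n μ
  have h1' := mul_le_mul_of_nonneg_left (Int.ofNat_le.2 h1) (zero_le_two (α := ℤ))
  rw [Nat.cast_add, mul_add, h4, h5, h6, Nat.cast_sub (by omega), Nat.cast_sub (by omega), he] at h1'
  have hN' : (N : ℤ) = μ ^ 2 - e := by zify at hN; linarith
  have h7 : ((e : ℤ) + 1) * (μ ^ 2 - e + 1 - μ) ≤ μ ^ 2 - μ := by
    push_cast at h1'
    rw [hN'] at h1'
    linarith
  -- The left side of `h7` equals this product plus μ ^ 2 - μ + 1, a contradiction; the second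
  -- factor is nonnegative because tdeg Q ≤ μ ^ 2.
  have h8 : (e : ℤ) * (μ ^ 2 - μ - e) ≥ 0 := by
    refine mul_nonneg (by positivity) ?_
    zify at he hQle
    linarith
  nlinarith

theorem card_filter_zero_mem [DecidableEq K] (hμ : 0 < μ) (hL : μ ^ 2 + μ ≤ L)
    (hS : μ ^ 2 + μ < #S) {y : K} (hy : y ∈ S) (hTy : #(T y) = μ) :
    #{y ∈ S | 0 ∈ T y} ≤ μ ∨ #S + 1 ≤ #{y ∈ S | 0 ∈ T y} + μ := by
  have hL2 : 2 * μ ≤ L := by nlinarith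
  obtain ⟨Q, hQI, hQd, hQt⟩ := h.exists_recurrence_tdeg_le hμ hL hS hy hTy
  have hQ0 : Q ≠ 0 := by
    rintro rfl
    simp at hQd
    omega
  by_cases h0 : Q.coeff 0 = 0
  · right
    obtain ⟨P, rfl⟩ := X_dvd_iff.2 h0
    have hP0 : P ≠ 0 := right_ne_zero_of_mul hQ0
    rw [natDegree_X_mul hP0] at hQd
    rw [tdeg_mul X_ne_zero hP0, ← pow_one X, tdeg_X_pow] at hQt
    -- Otherwise P would be a nonzero recurrence of degree less than μ, since X^(i+1) P = X^i Q for
    -- the original Q = XP.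
    have hτ : momentFunctional π P ≠ 0 := by
      intro hτ
      refine hP0 (h.eq_zero_of_degree_lt hL2 hy hTy (mem_recurrences.2 ?_)
        ((natDegree_lt_iff_degree_lt hP0).1 (by omega)))
      rintro (_ | i) hi
      · simpa using hτ
      · rw [pow_succ, mul_assoc]
        exact mem_recurrences.1 hQI i (by omega)
    -- Where 0 is not in `T y`, every root of XP in `T y` is a root of P, so the moment of P
    -- vanishes at y.
    have h1 : #{y ∈ S | 0 ∉ T y} ≤ (momentFunctional π P).natDegree := by
      by_contra! hlt
      refine hτ (eq_zero_of_natDegree_lt_card_of_eval_eq_zero' _ _ (fun z hz => ?_) hlt)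
      obtain ⟨hz, hz0⟩ := mem_filter.1 hz
      rw [h.eval_momentFunctional (by omega) hz]
      refine Finset.sum_eq_zero fun t ht => ?_
      have h2 := h.eval_specialize_eq_zero hQI (by rw [natDegree_X_mul hP0]; omega) hz ht
      rw [specialize_mul_eval, mul_eq_zero] at h2
      rcases h2 with h2 | h2
      · simp at h2
        exact absurd (h2 ▸ ht) hz0
      · rw [h2, mul_zero]
    have h2 := natDegree_momentFunctional_le h.natDegree_le P
    have h3 := card_filter_add_card_filter_not (s := S) (fun y => 0 ∈ T y)
    omega
  · left
    have h1 := natDegree_coeff_add_le Q h0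
    refine le_trans ?_ (h1.trans hQt)
    by_contra! hlt
    refine h0 (eq_zero_of_natDegree_lt_card_of_eval_eq_zero' _ _ (fun z hz => ?_) hlt)
    obtain ⟨hz, hz0⟩ := mem_filter.1 hz
    have h2 := h.eval_specialize_eq_zero hQI (by omega) hz hz0
    simpa [← coeff_zero_eq_eval_zero] using h2

end IsMomentSystem

end Counting

/-! ### Power sums of a multiset as a moment system. -/

section PowerSums

variable {K : Type*} [Field K]

/-- The power sums of the values of the linear forms `b - Y a` at the points `(a, b)` of a
multiset. -/
noncomputable def powerSum (A : Multiset (K × K)) (k : ℕ) : K[X] :=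
  (A.map fun p => (C p.2 - X * C p.1) ^ k).sum

theorem natDegree_powerSum_le (A : Multiset (K × K)) (k : ℕ) : (powerSum A k).natDegree ≤ k := by
  induction A using Multiset.induction with
  | empty => simp [powerSum]
  | cons p A ih =>
    rw [powerSum, Multiset.map_cons, Multiset.sum_cons]
    refine natDegree_add_le_of_degree_le ?_ ih
    have h1 : (C p.2 - X * C p.1 : K[X]).natDegree ≤ 1 :=
      natDegree_sub_le_of_le ((natDegree_C _).trans_le zero_le_one) ((natDegree_mul_C_le _ _).trans natDegree_X_le)
    simpa using natDegree_pow_le_of_le k h1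

theorem eval_powerSum (A : Multiset (K × K)) (k : ℕ) (y : K) :
    (powerSum A k).eval y = ((A.map fun p => p.2 - y * p.1).map (· ^ k)).sum := by
  induction A using Multiset.induction with
  | empty => simp [powerSum]
  | cons p A ih =>
    rw [powerSum, Multiset.map_cons, Multiset.sum_cons, eval_add, ← powerSum, ih]
    simp [mul_comm y]

variable [Fintype K] [DecidableEq K]

/-- The elements `t` for which the number of points `(a, b)` of `A` on the line `b - y a = t` is
not `m` modulo the characteristic. -/
noncomputable def exceptional (A : Multiset (K × K)) (m : ℕ) (y : K) : Finset K :=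
  {t | ¬ (A.map fun p => p.2 - y * p.1).count t ≡ m [MOD ringChar K]}

/-- Since ∑ t^k = 0 for k < q - 1, subtracting `m y` from every count leaves the power sum unchanged
and kills exactly the terms of the non-exceptional t. -/
theorem isMomentSystem_exceptional (A : Multiset (K × K)) (m : K → ℕ) (S : Finset K) {μ : ℕ}
    (hμ : ∀ y ∈ S, #(exceptional A (m y) y) ≤ μ) :
    IsMomentSystem (powerSum A) S (fun y => exceptional A (m y) y)
      (fun y t => ((A.map fun p => p.2 - y * p.1).count t : K) - m y)
      (Fintype.card K - 1) μ where
  natDegree_le := natDegree_powerSum_le A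
  weight_ne_zero y _ t ht := by
    rw [sub_ne_zero, Ne, CharP.natCast_eq_natCast K (ringChar K)]
    simpa [exceptional] using ht
  card_le := hμ
  eval_eq k hk y _ := by
    rw [eval_powerSum, Finset.sum_subset (subset_univ _)]
    · simp only [sub_mul, sum_sub_distrib]
      rw [← Finset.mul_sum, FiniteField.sum_pow_lt_card_sub_one K k hk, mul_zero, sub_zero,
        Finset.sum_multiset_map_count]
      rw [Finset.sum_subset (subset_univ _)]
      · simp
      · intro t _ ht
        rw [Multiset.count_eq_zero.2 (by simpa using ht), zero_smul]
    · intro t _ ht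
      have h1 : (A.map fun p => p.2 - y * p.1).count t ≡ m y [MOD ringChar K] := by
        simpa [exceptional] using ht
      rw [(CharP.natCast_eq_natCast K (ringChar K)).2 h1, sub_self, zero_mul]

/-- Two incongruent typical numbers would make the two exceptional sets cover K. -/
theorem modEq_of_card_exceptional_le {A : Multiset (K × K)} {m m' lam : ℕ} {y : K}
    (hlam : 2 * lam < Fintype.card K) (hm : #(exceptional A m y) ≤ lam)
    (hm' : #(exceptional A m' y) ≤ lam) : m ≡ m' [MOD ringChar K] := by
  by_contra hne
  have h1 : (univ : Finset K) ⊆ exceptional A m y ∪ exceptional A m' y := by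
    intro t _
    by_contra ht
    simp only [exceptional, mem_union, mem_filter, mem_univ, true_and, not_or, not_not] at ht
    exact hne (ht.1.symm.trans ht.2)
  have h2 := (card_le_card h1).trans (card_union_le _ _)
  rw [card_univ] at h2
  omega

/-- The order μ is the maximal number of exceptional values, not `lam`, because the curve argument
needs a slope that attains it. -/
theorem card_filter_zero_mem_exceptional (A : Multiset (K × K)) (m : K → ℕ) (S : Finset K)
    {lam : ℕ} (hpos : 0 < lam) (hlam : ∀ y ∈ S, #(exceptional A (m y) y) ≤ lam)
    (hS : lam ^ 2 + lam < #S) :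
    #{y ∈ S | 0 ∈ exceptional A (m y) y} ≤ lam ∨
      #S + 1 ≤ #{y ∈ S | 0 ∈ exceptional A (m y) y} + lam := by
  obtain ⟨y₀, hy₀, hmax⟩ := S.exists_max_image (fun y => #(exceptional A (m y) y))
    (card_pos.1 (by omega))
  set μ := #(exceptional A (m y₀) y₀) with hμ
  have hμlam : μ ≤ lam := hlam y₀ hy₀
  have hle : μ ^ 2 + μ ≤ lam ^ 2 + lam := by gcongr
  rcases Nat.eq_zero_or_pos μ with h0 | hμpos
  · left
    rw [filter_false_of_mem]
    · simp
    · intro y hy hy0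
      have h1 := card_pos.2 ⟨_, hy0⟩
      have h2 := hmax y hy
      omega
  -- From μ ^ 2 + μ < #S ≤ q follows μ ^ 2 + μ ≤ q - 1, the range in which the power sums are
  -- controlled.
  · have hq := card_le_univ S
    rcases (isMomentSystem_exceptional A m S hmax).card_filter_zero_mem hμpos (by omega) (by omega)
      hy₀ rfl with h1 | h1
    · exact Or.inl (h1.trans hμlam)
    · right
      omega

end PowerSums

/-! ### Slopes and intercepts as coordinates for directions and lines. -/

section Coordinates

variable {K : Type*} [Field K]

theorem exists_linearEquiv_apply_eq {v : K × K} (hv : v ≠ 0) :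
    ∃ e : (K × K) ≃ₗ[K] (K × K), e v = (0, 1) := by
  obtain ⟨u, hu⟩ : ∃ u : K × K, ∀ s t : K, s • u + t • v = 0 → s = 0 ∧ t = 0 := by
    obtain ⟨a, b⟩ := v
    by_cases hb : b = 0
    · have ha : a ≠ 0 := by rintro rfl; exact hv (by simp [hb])
      refine ⟨(0, 1), fun s t h => ?_⟩
      simp_all
    · refine ⟨(1, 0), fun s t h => ?_⟩
      have h1 := congrArg Prod.fst h
      have h2 := congrArg Prod.snd h
      simp_all
  let g : (K × K) →ₗ[K] (K × K) :=
    (LinearMap.fst K K K).smulRight u + (LinearMap.snd K K K).smulRight v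
  have hg : Function.Injective g := by
    rw [injective_iff_map_eq_zero]
    rintro ⟨s, t⟩ h
    obtain ⟨h1, h2⟩ := hu s t (by simpa [g] using h)
    rw [h1, h2, Prod.mk_zero_zero]
  refine ⟨(LinearEquiv.ofInjectiveEndo g hg).symm, ?_⟩
  rw [LinearEquiv.symm_apply_eq]
  simp [g]

/-- The direction of slope `y` with respect to the coordinates `e`. -/
noncomputable def slopeDirection (e : (K × K) ≃ₗ[K] (K × K)) (y : K) : ℙ K (K × K) :=
  Projectivization.mk K (e.symm (1, y)) (by simp)

variable (e : (K × K) ≃ₗ[K] (K × K))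

theorem mem_submodule_slopeDirection {y : K} {P : K × K} :
    P ∈ (slopeDirection e y).submodule ↔ (e P).2 - y * (e P).1 = 0 := by
  rw [slopeDirection, Projectivization.submodule_mk, Submodule.mem_span_singleton]
  constructor
  · rintro ⟨a, rfl⟩
    simp [mul_comm]
  · intro h
    refine ⟨(e P).1, ?_⟩
    rw [← map_smul, LinearEquiv.symm_apply_eq]
    ext
    · simp
    · simp [sub_eq_zero.1 h, mul_comm]

theorem slopeDirection_injective : Function.Injective (slopeDirection e) := by
  intro y z h
  have h1 : e.symm (1, y) ∈ (slopeDirection e z).submodule := by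
    rw [← h, mem_submodule_slopeDirection]
    simp
  rw [mem_submodule_slopeDirection] at h1
  simpa [sub_eq_zero] using h1

theorem range_slopeDirection {v : ℙ K (K × K)} (hv : e v.rep = (0, 1)) :
    Set.range (slopeDirection e) = {v}ᶜ := by
  ext d
  simp only [Set.mem_range, Set.mem_compl_iff, Set.mem_singleton_iff]
  constructor
  · rintro ⟨y, rfl⟩ h
    have h1 : v.rep ∈ (slopeDirection e y).submodule := by
      rw [h, Projectivization.submodule_eq]
      exact Submodule.mem_span_singleton_self _
    rw [mem_submodule_slopeDirection] at h1
    simp [hv] at h1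
  · intro hd
    have h0 : (e d.rep).1 ≠ 0 := by
      intro h0
      apply hd
      rw [← d.mk_rep, ← v.mk_rep, Projectivization.mk_eq_mk_iff']
      refine ⟨(e d.rep).2, ?_⟩
      apply e.injective
      rw [map_smul, hv]
      ext <;> simp [h0]
    refine ⟨(e d.rep).2 / (e d.rep).1, ?_⟩
    apply Projectivization.submodule_injective
    symm
    refine Submodule.eq_of_le_of_finrank_eq ?_ (by simp only [Projectivization.finrank_submodule])
    rw [Projectivization.submodule_eq, Submodule.span_singleton_le_iff_mem,
      mem_submodule_slopeDirection]
    field_simp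
    simp

/-- The line of slope `y` and intercept `t` in the coordinates `e` with origin `R`. -/
noncomputable def coordinateLine (R : K × K) (y t : K) : AffineSubspace K (K × K) :=
  AffineSubspace.mk' (R + e.symm (0, t)) (slopeDirection e y).submodule

theorem mem_coordinateLine {R P : K × K} {y t : K} :
    P ∈ coordinateLine e R y t ↔ (e (P - R)).2 - y * (e (P - R)).1 = t := by
  rw [coordinateLine, AffineSubspace.mem_mk', mem_submodule_slopeDirection, vsub_eq_sub,
    ← sub_sub, map_sub e (P - R)]
  simp only [LinearEquiv.apply_symm_apply, Prod.snd_sub, Prod.fst_sub, sub_zero]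
  rw [sub_right_comm, sub_eq_zero]

theorem coordinateLine_injective (R : K × K) (y : K) :
    Function.Injective (coordinateLine e R y) := by
  intro s t h
  have h1 : R + e.symm (0, s) ∈ coordinateLine e R y t := by
    rw [← h, mem_coordinateLine]
    simp
  rw [mem_coordinateLine] at h1
  simpa using h1

theorem range_coordinateLine (R : K × K) (y : K) :
    Set.range (coordinateLine e R y) = parallelClass (slopeDirection e y) := by
  ext l
  constructor
  · rintro ⟨t, rfl⟩
    exact AffineSubspace.direction_mk' _ _
  · intro hl
    have hl' : l.direction = (slopeDirection e y).submodule := hl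
    have hne : l ≠ ⊥ := by
      rintro rfl
      have := (slopeDirection e y).finrank_submodule
      rw [← hl', AffineSubspace.direction_bot, finrank_bot] at this
      exact zero_ne_one this
    obtain ⟨P, hP⟩ := (AffineSubspace.nonempty_iff_ne_bot l).2 hne
    refine ⟨(e (P - R)).2 - y * (e (P - R)).1, ?_⟩
    have h1 := (mem_coordinateLine e (R := R) (P := P) (y := y)).2 rfl
    rw [← AffineSubspace.mk'_eq hP, ← AffineSubspace.mk'_eq h1, hl', coordinateLine,
      AffineSubspace.direction_mk']

theorem intersectionNumber_coordinateLine [DecidableEq K] (M : Multiset (K × K)) (R : K × K)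
    (y t : K) : intersectionNumber M (coordinateLine e R y t) =
      ((M.map fun P => e (P - R)).map fun p => p.2 - y * p.1).count t := by
  classical
  rw [intersectionNumber, Multiset.map_map, Multiset.count_map, Multiset.countP_eq_card_filter]
  congr 1
  refine Multiset.filter_congr fun P _ => ?_
  rw [mem_coordinateLine]
  exact eq_comm

theorem isTypicalNumber_slopeDirection [Fintype K] [DecidableEq K] {M : Multiset (K × K)}
    {lam : ℕ} (R : K × K) {y : K} {m : ℕ} :
    IsTypicalNumber M lam (slopeDirection e y) m ↔
      #(exceptional (M.map fun P => e (P - R)) m y) ≤ lam := by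
  have h1 : {l ∈ parallelClass (slopeDirection e y) |
      intersectionNumber M l ≡ m [MOD ringChar K]} = coordinateLine e R y ''
        (((exceptional (M.map fun P => e (P - R)) m y)ᶜ : Finset K) : Set K) := by
    rw [← range_coordinateLine e R]
    ext l
    constructor
    · rintro ⟨⟨t, rfl⟩, ht⟩
      refine ⟨t, ?_, rfl⟩
      rw [intersectionNumber_coordinateLine] at ht
      simpa [exceptional] using ht
    · rintro ⟨t, ht, rfl⟩
      refine ⟨⟨t, rfl⟩, ?_⟩
      rw [intersectionNumber_coordinateLine]
      simpa [exceptional] using ht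
  have h2 := card_add_card_compl (exceptional (M.map fun P => e (P - R)) m y)
  rw [IsTypicalNumber, h1, Set.ncard_image_of_injective _ (coordinateLine_injective e R y),
    Set.ncard_coe_finset, Nat.card_eq_fintype_card]
  omega

end Coordinates

/-! ### Renitent lines through a point, with one direction set aside. -/

section Renitent

variable {K : Type*} [Field K]

/-- The directions of the renitent lines incident with `R`. -/
def renitentDirections (M : Multiset (K × K)) (lam : ℕ) (R : K × K) : Set (ℙ K (K × K)) :=
  {d | IsRenitent M lam (AffineSubspace.mk' R d.submodule)}

theorem renitentDirections_subset (M : Multiset (K × K)) (lam : ℕ) (R : K × K) :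
    renitentDirections M lam R ⊆ uniformDirections M lam := by
  rintro d ⟨d', m, hm, hd, -⟩
  have h : d = d' := Projectivization.submodule_injective
    ((AffineSubspace.direction_mk' R d.submodule).symm.trans hd)
  exact ⟨m, h ▸ hm⟩

theorem ncard_renitentLinesThrough (M : Multiset (K × K)) (lam : ℕ) (R : K × K) :
    (renitentLinesThrough M lam R).ncard = (renitentDirections M lam R).ncard := by
  have h1 : renitentLinesThrough M lam R =
      (fun d : ℙ K (K × K) => AffineSubspace.mk' R d.submodule) '' renitentDirections M lam R := by
    ext l
    constructor
    · rintro ⟨⟨d, m, hm, hl, hne⟩, hR⟩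
      have hl' : l.direction = d.submodule := hl
      have h2 : AffineSubspace.mk' R d.submodule = l := by rw [← hl', AffineSubspace.mk'_eq hR]
      refine ⟨d, ⟨d, m, hm, ?_, ?_⟩, h2⟩
      · rwa [h2]
      · rwa [h2]
    · rintro ⟨d, hd, rfl⟩
      exact ⟨hd, AffineSubspace.self_mem_mk' _ _⟩
  rw [h1, Set.ncard_image_of_injective]
  intro d d' h
  apply Projectivization.submodule_injective
  simpa using congrArg AffineSubspace.direction h

/-- Making `v` vertical turns the other directions into slopes in K and the lines through `R` into
those of intercept 0. -/
theorem ncard_renitentDirections_diff [Finite K] {M : Multiset (K × K)} {lam : ℕ} (R : K × K)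
    (hpos : 0 < lam) (hlam : 2 * lam < Nat.card K) (v : ℙ K (K × K))
    (hF : lam ^ 2 + lam < (uniformDirections M lam \ {v}).ncard) :
    (renitentDirections M lam R \ {v}).ncard ≤ lam ∨
      (uniformDirections M lam \ {v}).ncard + 1 ≤
        (renitentDirections M lam R \ {v}).ncard + lam := by
  classical
  have := Fintype.ofFinite K
  obtain ⟨e, he⟩ := exists_linearEquiv_apply_eq v.rep_nonzero
  have hrange := range_slopeDirection e he
  have hpre : ∀ s : Set (ℙ K (K × K)), s \ {v} = slopeDirection e '' (slopeDirection e ⁻¹' s) := by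
    intro s
    rw [Set.image_preimage_eq_inter_range, hrange, Set.sdiff_eq]
  have hcard : ∀ s : Set (ℙ K (K × K)),
      (s \ {v}).ncard = ({y | slopeDirection e y ∈ s} : Finset K).card := by
    intro s
    rw [hpre, Set.ncard_image_of_injective _ (slopeDirection_injective e),
      ← Set.ncard_coe_finset]
    congr 1
    ext
    simp
  have hlam' : 2 * lam < Fintype.card K := by rwa [← Nat.card_eq_fintype_card]
  set A := M.map fun P => e (P - R) with hA
  have hm : ∀ y, ∃ m, slopeDirection e y ∈ uniformDirections M lam →
      IsTypicalNumber M lam (slopeDirection e y) m := fun y => by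
    by_cases h : slopeDirection e y ∈ uniformDirections M lam
    · obtain ⟨m, hm⟩ := h
      exact ⟨m, fun _ => hm⟩
    · exact ⟨0, fun h' => absurd h' h⟩
  choose m hm using hm
  have hR : ∀ y, AffineSubspace.mk' R (slopeDirection e y).submodule = coordinateLine e R y 0 := by
    intro y
    rw [coordinateLine, Prod.mk_zero_zero, map_zero, add_zero]
  have hren : ({y | slopeDirection e y ∈ renitentDirections M lam R} : Finset K) =
      {y ∈ ({y | slopeDirection e y ∈ uniformDirections M lam} : Finset K) |
        0 ∈ exceptional A (m y) y} := by
    ext y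
    simp only [Finset.mem_filter, Finset.mem_univ, true_and, exceptional]
    rw [hA, ← intersectionNumber_coordinateLine, ← hR]
    constructor
    · intro hy
      have hyF := renitentDirections_subset M lam R hy
      refine ⟨hyF, fun hmod => ?_⟩
      obtain ⟨d, m', hm', hd, hne⟩ := hy
      obtain rfl : slopeDirection e y = d := Projectivization.submodule_injective
        ((AffineSubspace.direction_mk' R (slopeDirection e y).submodule).symm.trans hd)
      refine hne (hmod.trans (modEq_of_card_exceptional_le (K := K) (A := A) (y := y) hlam'
        ((isTypicalNumber_slopeDirection e R).1 (hm y hyF))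
        ((isTypicalNumber_slopeDirection e R).1 hm')))
    · rintro ⟨hyF, hne⟩
      exact ⟨_, m y, hm y hyF, AffineSubspace.direction_mk' _ _, hne⟩
  rw [hcard] at hF
  rw [hcard, hcard, hren]
  exact card_filter_zero_mem_exceptional A m _ hpos
    (fun y hy => (isTypicalNumber_slopeDirection e R).1 (hm y (by simpa using hy))) hF

/-- Both n and n + 1 exceed 1, so a prime power equal to their product would give them a common
prime factor. This excludes the borderline q = lam ^ 2 + lam. -/
theorem not_isPrimePow_sq_add {n : ℕ} (hn : 1 < n) : ¬ IsPrimePow (n ^ 2 + n) := by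
  rw [isPrimePow_nat_iff]
  rintro ⟨p, k, hp, -, h⟩
  have h1 : n ∣ p ^ k := ⟨n + 1, by rw [h]; ring⟩
  have h2 : n + 1 ∣ p ^ k := ⟨n, by rw [h]; ring⟩
  have h3 : p ∣ n := by
    have hn' := Nat.minFac_prime hn.ne'
    rw [← (Nat.prime_dvd_prime_iff_eq hn' hp).1
      (hn'.dvd_of_dvd_pow ((Nat.minFac_dvd n).trans h1))]
    exact Nat.minFac_dvd n
  have h4 : p ∣ n + 1 := by
    have hn' := Nat.minFac_prime (n := n + 1) (by omega)
    rw [← (Nat.prime_dvd_prime_iff_eq hn' hp).1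
      (hn'.dvd_of_dvd_pow ((Nat.minFac_dvd (n + 1)).trans h2))]
    exact Nat.minFac_dvd (n + 1)
  exact hp.one_lt.ne' (Nat.dvd_one.1 ((Nat.dvd_add_right h3).1 h4))

end Renitent

end AffinePlane

/-! ### Choice of the direction set aside. -/

theorem theorem4p3 {K : Type*} [Field K] [Finite K] (hq : 2 < Nat.card K)
    (M : Multiset (K × K)) (lam : ℕ) (hpos : 0 < lam)
    (hlam : (lam : ℝ) ≤ ((Nat.card K : ℝ) - 1) / 2)
    (hF : lam ^ 2 + lam < (AffinePlane.uniformDirections M lam).ncard)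
    (R : K × K) :
    (AffinePlane.renitentLinesThrough M lam R).ncard ≤ lam ∨
      ((AffinePlane.uniformDirections M lam).ncard : ℤ) + 1 - (lam : ℤ) ≤
        ((AffinePlane.renitentLinesThrough M lam R).ncard : ℤ) := by
  have hlam' : 2 * lam < Nat.card K := by
    have h1 : (2 * lam + 1 : ℝ) ≤ Nat.card K := by linarith
    exact_mod_cast h1
  rw [AffinePlane.ncard_renitentLinesThrough]
  set F := AffinePlane.uniformDirections M lam with hFdef
  set D := AffinePlane.renitentDirections M lam R with hD
  have hDF : D ⊆ F := AffinePlane.renitentDirections_subset M lam R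
  suffices h : D.ncard ≤ lam ∨ F.ncard + 1 ≤ D.ncard + lam by omega
  have key := AffinePlane.ncard_renitentDirections_diff (M := M) R hpos hlam'
  rw [← hFdef, ← hD] at key
  by_cases hall : F = Set.univ
  · have hcard : F.ncard = Nat.card K + 1 := by
      rw [hall, Set.ncard_univ, Projectivization.card_of_finrank_two K (K × K) (by simp)]
    have hFv : ∀ v, (F \ {v}).ncard + 1 = F.ncard := fun v =>
      Set.ncard_sdiff_singleton_add_one (hall ▸ Set.mem_univ v)
    -- Only q uniform directions remain after one is removed, so the strict bound is needed with q
    -- in place of q + 1.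
    have hlt : lam ^ 2 + lam < Nat.card K := by
      refine lt_of_le_of_ne (by omega) fun h => ?_
      have := Fintype.ofFinite K
      have h1 := FiniteField.isPrimePow_card K
      rw [← Nat.card_eq_fintype_card, ← h] at h1
      refine AffinePlane.not_isPrimePow_sq_add ?_ h1
      by_contra h2
      obtain rfl : lam = 1 := by omega
      omega
    rcases D.eq_empty_or_nonempty with h0 | ⟨v₁, hv₁⟩
    · left
      rw [h0, Set.ncard_empty]
      omega
    by_cases h2 : D = Set.univ
    · right
      rw [h2, hall]
      omega
    obtain ⟨v₂, hv₂⟩ := (Set.ne_univ_iff_exists_notMem D).1 h2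
    -- Removing v₁ ∈ D gives |D| ≤ lam + 1 or |D| ≥ q + 2 - lam; removing v₂ ∉ D gives |D| ≤ lam or
    -- |D| ≥ q + 1 - lam. As 2 lam < q, only |D| ≤ lam or |D| ≥ q + 2 - lam is left.
    have k1 := key v₁ (by have := hFv v₁; omega)
    have k2 := key v₂ (by have := hFv v₂; omega)
    rw [Set.sdiff_singleton_eq_self hv₂] at k2
    have e1 := Set.ncard_sdiff_singleton_add_one hv₁
    have e2 := hFv v₁
    have e3 := hFv v₂
    have e4 : lam ≤ lam ^ 2 := Nat.le_self_pow two_ne_zero lam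
    omega
  · obtain ⟨v, hv⟩ := (Set.ne_univ_iff_exists_notMem F).1 hall
    have k := key v
    rw [Set.sdiff_singleton_eq_self hv, Set.sdiff_singleton_eq_self fun h => hv (hDF h)] at k
    exact k hF
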